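/- Let $k$ be a field, $H$ a prime ideal of $Q=k[X_1,\dots,X_s]$, $A=Q/H$, let $L$ be a prime ideal of $A$, $A_L$ the localization of $A$ at $L$, and $\mathfrak a=L\cdot A_L$ its maximal ideal. Let $\mathrm{Gr}=\mathrm{Gr}_{\mathfrak a}(A_L)=\bigoplus_{n\ge 0}\mathfrak a^n/\mathfrak a^{n+1}$. For $0\ne c\in A_L$ with $c\in\mathfrak a^n\setminus\mathfrak a^{n+1}$ let $\mathrm{in}_{\mathfrak a}(c)$ be the class of $c$ in $\mathfrak a^n/\mathfrak a^{n+1}$, put $\mathrm{in}_{\mathfrak a}(0)=0$, and for an ideal $I$ of $A_L$ let $\mathrm{in}_{\mathfrak a}(I)$ be the ideal of $\mathrm{Gr}$ generated by all $\mathrm{in}_{\mathfrak a}(c)$, $c\in I$. For integers $d_1,\dots,d_r$ the free module $M=\bigoplus_{i=1}^r A_L(-d_i)$ carries the filtration $F^mM=\bigoplus_i\mathfrak a^{m-d_i}$ ($m\in\mathbb Z$, $\mathfrak a^n:=A_L$ for $n\le 0$), and its associated graded module is $N=\bigoplus_{i=1}^r\mathrm{Gr}(-d_i)$ with $N_m=\bigoplus_i\mathrm{Gr}_{m-d_i}=F^mM/F^{m+1}M$.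 For $g\in F^mM\setminus F^{m+1}M$ let $\mathrm{in}_{\mathfrak a}(g)$ be the class of $g$ in $N_m$, and put $\mathrm{in}_{\mathfrak a}(0)=0$. Let $I$ be an ideal of $A_L$. (1) For every $n\ge 0$ and $x\in\mathfrak a^n$, the class of $x$ in $\mathfrak a^n/\mathfrak a^{n+1}$ lies in $\mathrm{in}_{\mathfrak a}(I)$ if and only if $x\in I+\mathfrak a^{n+1}$; that is, taking classes is compatible with the projections $A_L\to A_L/I$ and $\mathrm{Gr}\to\mathrm{Gr}/\mathrm{in}_{\mathfrak a}(I)$. (2) Let $$0\leftarrow \mathrm{Gr}/\mathrm{in}_{\mathfrak a}(I)\leftarrow\mathrm{Gr}\xleftarrow{\ \partial_1\ }N_1\xleftarrow{\ \partial_2\ }N_2\leftarrow\cdots$$ be a graded free resolution over $\mathrm{Gr}$ (the first map being the canonical projection), with $N_k=\bigoplus_{j\in\mathbb Z}\mathrm{Gr}(-j)^{b_{j-k,k}}$ of finite rank and all maps homogeneous of degree $0$. Then there is a free resolution $$0\leftarrow A_L/I\leftarrow A_L\xleftarrow{\ \delta_1\ }M_1\xleftarrow{\ \delta_2\ }M_2\leftarrow\cdots$$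 over $A_L$ with $M_k=\bigoplus_{j\in\mathbb Z}A_L(-j)^{b_{j-k,k}}$ (the same $b_{j-k,k}$) such that every $\delta_k$ maps the $m$-th filtration submodule into the $m$-th filtration submodule for all $m$ and induces $\partial_k$ on the associated graded modules, and such that $\mathrm{in}_{\mathfrak a}(\delta_k(e))=\partial_k(e)$ for every canonical basis vector $e$. (3) In particular, if $A_L$ is a regular local ring, then every ideal $I$ of $A_L$ has a finite free resolution: there is an exact sequence $0\leftarrow A_L/I\leftarrow A_L\leftarrow M_1\leftarrow\cdots\leftarrow M_N\leftarrow 0$ with all $M_k$ free of finite rank. -/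

import Mathlib

noncomputable section

/-! ### The associated graded ring `⨁ₙ 𝔞ⁿ / 𝔞ⁿ⁺¹` -/

section AssocGraded

variable {R : Type*} [CommRing R] (a : Ideal R)

/-- The `n`-th graded piece `𝔞ⁿ / 𝔞ⁿ⁺¹`. -/
def GrPiece (n : ℕ) : Type _ :=
  ↥(a ^ n) ⧸ Submodule.comap (a ^ n).subtype (a ^ (n + 1))

instance (n : ℕ) : AddCommGroup (GrPiece a n) :=
  inferInstanceAs (AddCommGroup (↥(a ^ n) ⧸ Submodule.comap (a ^ n).subtype (a ^ (n + 1))))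

instance (n : ℕ) : Module R (GrPiece a n) :=
  inferInstanceAs (Module R (↥(a ^ n) ⧸ Submodule.comap (a ^ n).subtype (a ^ (n + 1))))

/-- The residue class in `𝔞ⁿ / 𝔞ⁿ⁺¹` of an element of `𝔞ⁿ`. -/
def GrPiece.mk (n : ℕ) : ↥(a ^ n) →ₗ[R] GrPiece a n :=
  Submodule.mkQ (Submodule.comap (a ^ n).subtype (a ^ (n + 1)))

theorem GrPiece.mk_surjective (n : ℕ) : Function.Surjective (GrPiece.mk a n) :=
  Submodule.mkQ_surjective _

theorem GrPiece.mk_eq_zero_iff (n : ℕ) (x : ↥(a ^ n)) :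
    GrPiece.mk a n x = 0 ↔ (x : R) ∈ a ^ (n + 1) := by
  unfold GrPiece.mk
  exact Submodule.Quotient.mk_eq_zero (Submodule.comap (a ^ n).subtype (a ^ (n + 1)))

/-- The multiplication `𝔞ⁱ × 𝔞ʲ → 𝔞ⁱ⁺ʲ`, as a bilinear map. -/
def powMul (i j : ℕ) : ↥(a ^ i) →ₗ[R] ↥(a ^ j) →ₗ[R] ↥(a ^ (i + j)) :=
  LinearMap.mk₂ R
    (fun x y => ⟨(x : R) * (y : R), by rw [pow_add]; exact Ideal.mul_mem_mul x.2 y.2⟩)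
    (fun x x' y => Subtype.ext (add_mul _ _ _))
    (fun c x y => Subtype.ext (by simp [mul_assoc]))
    (fun x y y' => Subtype.ext (mul_add _ _ _))
    (fun c x y => Subtype.ext (by simp [mul_left_comm]))

/-- The multiplication `𝔞ⁱ/𝔞ⁱ⁺¹ × 𝔞ʲ/𝔞ʲ⁺¹ → 𝔞ⁱ⁺ʲ/𝔞ⁱ⁺ʲ⁺¹` induced by that of `R`. -/
def GrPiece.mul (i j : ℕ) : GrPiece a i →ₗ[R] GrPiece a j →ₗ[R] GrPiece a (i + j) :=
  Submodule.liftQ (Submodule.comap (a ^ i).subtype (a ^ (i + 1)))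
    { toFun := fun x => Submodule.liftQ (Submodule.comap (a ^ j).subtype (a ^ (j + 1)))
        ((GrPiece.mk a (i + j)).comp (powMul a i j x)) (by
          intro y hy
          have hy' : (y : R) ∈ a ^ (j + 1) := hy
          rw [LinearMap.mem_ker, LinearMap.comp_apply, GrPiece.mk_eq_zero_iff]
          change (x : R) * (y : R) ∈ _
          rw [add_assoc, pow_add]
          exact Ideal.mul_mem_mul x.2 hy')
      map_add' := by
        intro x x'
        refine LinearMap.ext fun y => ?_
        obtain ⟨y, rfl⟩ := GrPiece.mk_surjective a j y
        change GrPiece.mk a (i + j) (powMul a i j (x + x') y) =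
          GrPiece.mk a (i + j) (powMul a i j x y) + GrPiece.mk a (i + j) (powMul a i j x' y)
        simp
      map_smul' := by
        intro c x
        refine LinearMap.ext fun y => ?_
        obtain ⟨y, rfl⟩ := GrPiece.mk_surjective a j y
        change GrPiece.mk a (i + j) (powMul a i j (c • x) y) =
          c • GrPiece.mk a (i + j) (powMul a i j x y)
        simp }
    (by
      intro x hx
      have hx' : (x : R) ∈ a ^ (i + 1) := hx
      rw [LinearMap.mem_ker]
      ext y
      induction y using Submodule.Quotient.induction_on with
      | H y =>
        change GrPiece.mk a (i + j) (powMul a i j x y) = 0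
        rw [GrPiece.mk_eq_zero_iff]
        change (x : R) * (y : R) ∈ _
        rw [add_right_comm, pow_add]
        exact Ideal.mul_mem_mul hx' y.2)

theorem GrPiece.mul_mk (i j : ℕ) (x : ↥(a ^ i)) (y : ↥(a ^ j)) :
    GrPiece.mul a i j (GrPiece.mk a i x) (GrPiece.mk a j y) =
      GrPiece.mk a (i + j) (powMul a i j x y) := rfl

theorem GrPiece.gradedMk_eq {i j : ℕ} (h : i = j) (x : ↥(a ^ i)) (y : ↥(a ^ j))
    (hxy : (x : R) = y) :
    (GradedMonoid.mk i (GrPiece.mk a i x) : GradedMonoid (GrPiece a)) =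
      GradedMonoid.mk j (GrPiece.mk a j y) := by
  subst h
  rw [Subtype.ext hxy]

/-- The unit of the associated graded ring, the class of `1` in `𝔞⁰ / 𝔞¹`. -/
def GrPiece.one : GrPiece a 0 := GrPiece.mk a 0 ⟨1, by simp⟩

instance : GradedMonoid.GOne (GrPiece a) := ⟨GrPiece.one a⟩

instance : GradedMonoid.GMul (GrPiece a) := ⟨fun {i j} x y => GrPiece.mul a i j x y⟩

/-- The class of an element of `R = 𝔞⁰` in `𝔞⁰ / 𝔞¹`. -/
def GrPiece.ofRing (r : R) : GrPiece a 0 := GrPiece.mk a 0 ⟨r, by simp⟩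

instance : DirectSum.GCommRing (GrPiece a) where
  mul_zero x := map_zero _
  zero_mul x := by
    change GrPiece.mul a _ _ 0 x = 0
    simp
  mul_add x y z := map_add _ _ _
  add_mul x y z := by
    change GrPiece.mul a _ _ (x + y) z = GrPiece.mul a _ _ x z + GrPiece.mul a _ _ y z
    simp
  one_mul := by
    rintro ⟨i, x⟩
    obtain ⟨x, rfl⟩ := GrPiece.mk_surjective a i x
    exact GrPiece.gradedMk_eq a (zero_add i) _ _ (one_mul _)
  mul_one := by
    rintro ⟨i, x⟩
    obtain ⟨x, rfl⟩ := GrPiece.mk_surjective a i x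
    exact GrPiece.gradedMk_eq a (add_zero i) _ _ (mul_one _)
  mul_assoc := by
    rintro ⟨i, x⟩ ⟨j, y⟩ ⟨l, z⟩
    obtain ⟨x, rfl⟩ := GrPiece.mk_surjective a i x
    obtain ⟨y, rfl⟩ := GrPiece.mk_surjective a j y
    obtain ⟨z, rfl⟩ := GrPiece.mk_surjective a l z
    exact GrPiece.gradedMk_eq a (add_assoc i j l) _ _ (mul_assoc _ _ _)
  mul_comm := by
    rintro ⟨i, x⟩ ⟨j, y⟩
    obtain ⟨x, rfl⟩ := GrPiece.mk_surjective a i x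
    obtain ⟨y, rfl⟩ := GrPiece.mk_surjective a j y
    exact GrPiece.gradedMk_eq a (add_comm i j) _ _ (mul_comm _ _)
  natCast n := GrPiece.ofRing a n
  natCast_zero := by
    change GrPiece.mk a 0 _ = 0
    rw [GrPiece.mk_eq_zero_iff]
    simp
  natCast_succ n := by
    change GrPiece.mk a 0 _ = GrPiece.mk a 0 _ + GrPiece.mk a 0 _
    rw [← map_add]
    congr 1
    exact Subtype.ext (Nat.cast_succ n)
  intCast n := GrPiece.ofRing a n
  intCast_ofNat n := by
    change GrPiece.mk a 0 _ = GrPiece.mk a 0 _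
    congr 1
    exact Subtype.ext (Int.cast_natCast n)
  intCast_negSucc_ofNat n := by
    change GrPiece.mk a 0 _ = - GrPiece.mk a 0 _
    rw [← map_neg]
    congr 1
    exact Subtype.ext (Int.cast_negSucc n)

/-- The associated graded ring `Gr_𝔞(R) = ⨁ₙ 𝔞ⁿ / 𝔞ⁿ⁺¹`. -/
abbrev AssocGr : Type _ := DirectSum ℕ (GrPiece a)

/-- The class of `x ∈ 𝔞ⁿ` in the degree `n` part of `Gr_𝔞(R)`. -/
def grClass (n : ℕ) (x : ↥(a ^ n)) : AssocGr a :=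
  DirectSum.of (GrPiece a) n (GrPiece.mk a n x)

open Classical in
/-- The initial form of `c`: the class of `c` in `𝔞ⁿ / 𝔞ⁿ⁺¹` for the `n` with
`c ∈ 𝔞ⁿ \ 𝔞ⁿ⁺¹`, and `0` if there is no such `n` (in a Noetherian local ring with
`𝔞 ≠ R`: only for `c = 0`). -/
def initForm (c : R) : AssocGr a :=
  if h : ∃ n : ℕ, c ∈ a ^ n ∧ c ∉ a ^ (n + 1) then grClass a h.choose ⟨c, h.choose_spec.1⟩ else 0

/-- The initial ideal `in_𝔞(I) = ⟨in_𝔞(c) ∣ c ∈ I⟩`. -/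
def initIdeal (I : Ideal R) : Ideal (AssocGr a) :=
  Ideal.span (initForm a '' (I : Set R))

/-! ### Shifted free modules

For `d : Fin r → ℤ`, the free modules `⨁ᵢ R(-dᵢ)` and `⨁ᵢ Gr_𝔞(R)(-dᵢ)` have underlying modules
`Fin r → R` and `Fin r → AssocGr a`; the basis vector `eᵢ` has order, respectively degree, `dᵢ`. -/

/-- `v` is homogeneous of degree `m` in `⨁ᵢ Gr_𝔞(R)(-dᵢ)`: the `i`-th coordinate lies in
`Gr_𝔞(R)_{m - dᵢ}` (which is `0` if `m < dᵢ`). -/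
def IsHomogVec {r : ℕ} (d : Fin r → ℤ) (m : ℤ) (v : Fin r → AssocGr a) : Prop :=
  ∀ (i : Fin r) (n : ℕ), (n : ℤ) ≠ m - d i → v i n = 0

/-- The `m`-th filtration submodule `⨁ᵢ 𝔞^{m - dᵢ}` of `⨁ᵢ R(-dᵢ)`, where `𝔞ⁿ = R` for
`n ≤ 0`. -/
def vecFilt {r : ℕ} (d : Fin r → ℤ) (m : ℤ) : Submodule R (Fin r → R) :=
  Submodule.pi Set.univ fun i => a ^ (m - d i).toNat

/-- The class in `⨁ᵢ Gr_𝔞(R)(-dᵢ)_m = ⨁ᵢ 𝔞^{m - dᵢ} / 𝔞^{m - dᵢ + 1}` of an element of the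
`m`-th filtration submodule of `⨁ᵢ R(-dᵢ)`; the `i`-th coordinate is `0` if `m < dᵢ`. -/
def vecClass {r : ℕ} (d : Fin r → ℤ) (m : ℤ) (x : ↥(vecFilt a d m)) : Fin r → AssocGr a :=
  fun i => if 0 ≤ m - d i then
    grClass a (m - d i).toNat ⟨x.1 i, x.2 i (Set.mem_univ i)⟩ else 0

open Classical in
/-- The initial form of `g ∈ ⨁ᵢ R(-dᵢ)`: the class of `g` in degree `m`, where `m` is the order of
`g`, i.e. `g` lies in the `m`-th but not in the `(m+1)`-st filtration submodule; `0` if there is no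
such `m`. -/
def vecInitForm {r : ℕ} (d : Fin r → ℤ) (g : Fin r → R) : Fin r → AssocGr a :=
  if h : ∃ m : ℤ, g ∈ vecFilt a d m ∧ g ∉ vecFilt a d (m + 1) then
    vecClass a d h.choose ⟨g, h.choose_spec.1⟩ else 0

end AssocGraded

/-! ### Free resolutions -/

/-- A resolution `0 ← S/I ← S ← S^{b 0} ← S^{b 1} ← ⋯` of `S/I` by free `S`-modules of finite rank,
starting with the canonical projection `S → S/I`. The module `S^{b k}` stands in homological
degree `k + 1`. -/
structure FreeRes (S : Type*) [CommRing S] (I : Ideal S) (b : ℕ → ℕ) where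
  /-- The map `S ← S^{b 0}`. -/
  aug : (Fin (b 0) → S) →ₗ[S] S
  /-- The map `S^{b k} ← S^{b (k + 1)}`. -/
  map : ∀ k : ℕ, (Fin (b (k + 1)) → S) →ₗ[S] (Fin (b k) → S)
  exact_quot : Function.Exact aug (Submodule.mkQ I)
  exact_aug : Function.Exact (map 0) aug
  exact_map : ∀ k : ℕ, Function.Exact (map (k + 1)) (map k)

section Lift

variable {R : Type*} [CommRing R] {a : Ideal R} {I : Ideal R} {b : ℕ → ℕ}

/-- The resolution `C` over `Gr_𝔞(R)` is graded with shifts `d`: its `k`-th module is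
`⨁ᵢ Gr_𝔞(R)(-d k i)` and all maps are homogeneous of degree `0`, i.e. the image of each basis
vector is homogeneous of the degree of that basis vector. The graded Betti numbers record the
shifts: `Gr_𝔞(R)(-j)` occurs in the `k`-th module exactly `#{i ∣ d k i = j}` times. -/
structure FreeRes.IsGraded {T : Ideal (AssocGr a)} (C : FreeRes (AssocGr a) T b)
    (d : ∀ k : ℕ, Fin (b k) → ℤ) : Prop where
  aug : ∀ (i : Fin (b 0)) (n : ℕ), (n : ℤ) ≠ d 0 i → C.aug (Pi.single i 1) n = 0
  map : ∀ (k : ℕ) (i : Fin (b (k + 1))),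
    IsHomogVec a (d k) (d (k + 1) i) (C.map k (Pi.single i 1))

/-- The resolution `D` of `R/I` with modules `⨁ᵢ R(-d k i)` is a lift of the resolution `C` of
`Gr_𝔞(R)/in_𝔞(I)` with modules `⨁ᵢ Gr_𝔞(R)(-d k i)`: the maps of `D` respect the filtrations,
they induce the maps of `C` on the associated graded modules, and the image of each basis vector
under a map of `D` has as its initial form the image of the corresponding basis vector under the
map of `C`. -/
structure FreeRes.IsLift (D : FreeRes R I b) (C : FreeRes (AssocGr a) (initIdeal a I) b)
    (d : ∀ k : ℕ, Fin (b k) → ℤ) : Prop where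
  aug_class : ∀ (n : ℕ) (x : ↥(vecFilt a (d 0) n)),
    ∃ h : D.aug x.1 ∈ a ^ n, grClass a n ⟨D.aug x.1, h⟩ = C.aug (vecClass a (d 0) n x)
  map_class : ∀ (k : ℕ) (m : ℤ) (x : ↥(vecFilt a (d (k + 1)) m)),
    ∃ h : D.map k x.1 ∈ vecFilt a (d k) m,
      vecClass a (d k) m ⟨D.map k x.1, h⟩ = C.map k (vecClass a (d (k + 1)) m x)
  aug_init : ∀ i : Fin (b 0), initForm a (D.aug (Pi.single i 1)) = C.aug (Pi.single i 1)
  map_init : ∀ (k : ℕ) (i : Fin (b (k + 1))),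
    vecInitForm a (d k) (D.map k (Pi.single i 1)) = C.map k (Pi.single i 1)

end Lift

end

/-! The set of `f` in Gr all of whose homogeneous components are classes of elements of `I` contains
the initial forms and is stable under sums and multiplication by classes. So a class of `x ∈ 𝔞ⁿ`
lying in `in(I)` equals the class of some `c ∈ I`, that is, `x - c ∈ 𝔞ⁿ⁺¹`; this is (1).

For (2) the resolution is lifted one map at a time, the invariant `IsInitSubmodule` saying that the
homogeneous elements of `K'` are exactly the classes of elements of `K`. It holds for `I` and
`in(I)` in rank one. In `exists_lift`, a homogeneous `φ` with image `K'` is lifted by sending basis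
vectors to representatives in `K` of their images; the resulting `δ` induces `φ`. Successive
approximation solves `δ z = y` modulo every filtration step, with `z` kept in the filtration step of
`y`, and Krull's intersection theorem makes the solution exact without completeness. Hence `δ` is
strict, and strictness passes the invariant on to the kernels of `δ` and `φ`.

Part (3) is independent of (2): it is the syzygy theorem, by induction on the embedding dimension.
For `x ∈ 𝔪 \ 𝔪²` the ring `R/x` is again regular, with smaller embedding dimension, and `x` is a
nonzerodivisor because `R` is a domain. Reducing a first syzygy module modulo `x` keeps its later
syzygies under control, and freeness modulo `x` lifts to `R`. -/

noncomputable section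

/-! ### Powers, classes and homogeneous components in integer degrees -/

section IntegerDegrees

variable {R : Type*} [CommRing R] (a : Ideal R)

/-- The power `𝔞ᵐ` for an integer `m`, where `𝔞ᵐ = R` for `m ≤ 0`. -/
def intPow (m : ℤ) : Ideal R := a ^ m.toNat

theorem mem_intPow_natCast {n : ℕ} {x : R} : x ∈ intPow a n ↔ x ∈ a ^ n := by
  simp [intPow]

theorem mem_intPow_of_nonpos {m : ℤ} (hm : m ≤ 0) (x : R) : x ∈ intPow a m := by
  simp [intPow, Int.toNat_of_nonpos hm]

theorem intPow_antitone : Antitone (intPow a) := fun _ _ h =>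
  Ideal.pow_le_pow_right (Int.toNat_le_toNat h)

theorem mul_mem_intPow {i j : ℤ} {x y : R} (hx : x ∈ intPow a i) (hy : y ∈ intPow a j) :
    x * y ∈ intPow a (i + j) := by
  have h : x * y ∈ a ^ (i.toNat + j.toNat) := by
    rw [pow_add]
    exact Ideal.mul_mem_mul hx hy
  exact Ideal.pow_le_pow_right (by lia) h

theorem grClass_mul (i j : ℕ) (x : ↥(a ^ i)) (y : ↥(a ^ j)) :
    grClass a i x * grClass a j y = grClass a (i + j) (powMul a i j x y) :=
  DirectSum.of_mul_of _ _

theorem grClass_eq_zero_iff (n : ℕ) (x : ↥(a ^ n)) :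
    grClass a n x = 0 ↔ (x : R) ∈ a ^ (n + 1) := by
  rw [← GrPiece.mk_eq_zero_iff]
  exact map_eq_zero_iff _ (DirectSum.of_injective n)

theorem grClass_congr {i j : ℕ} (h : i = j) (x : ↥(a ^ i)) (y : ↥(a ^ j)) (hxy : (x : R) = y) :
    grClass a i x = grClass a j y := by
  subst h
  rw [Subtype.ext hxy]

open Classical in
/-- The class of `x ∈ 𝔞ᵐ` in degree `m` of `Gr_𝔞(R)`, for an integer `m`. It is `0` if `m < 0`, and
by convention if `x ∉ 𝔞ᵐ`. -/
def intClass (m : ℤ) (x : R) : AssocGr a :=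
  if h : 0 ≤ m ∧ x ∈ intPow a m then grClass a m.toNat ⟨x, h.2⟩ else 0

theorem intClass_of_neg {m : ℤ} (hm : m < 0) (x : R) : intClass a m x = 0 :=
  dif_neg fun h => absurd h.1 (not_le.2 hm)

theorem intClass_of_nonneg {m : ℤ} (hm : 0 ≤ m) {x : R} (hx : x ∈ intPow a m) :
    intClass a m x = grClass a m.toNat ⟨x, hx⟩ :=
  dif_pos ⟨hm, hx⟩

theorem intClass_natCast (n : ℕ) (x : ↥(a ^ n)) : intClass a n (x : R) = grClass a n x := by
  have hx : (x : R) ∈ intPow a n := (mem_intPow_natCast a).2 x.2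
  rw [intClass_of_nonneg a (Int.natCast_nonneg n) hx]
  exact grClass_congr a (Int.toNat_natCast n) _ _ rfl

/-- Negative degrees need no exception: there the class is `0` by convention, and `𝔞ᵐ⁺¹ = R` since
`m + 1 ≤ 0`. -/
theorem intClass_eq_zero_iff {m : ℤ} {x : R} (hx : x ∈ intPow a m) :
    intClass a m x = 0 ↔ x ∈ intPow a (m + 1) := by
  rcases lt_or_ge m 0 with hm | hm
  · simp [intClass_of_neg a hm, mem_intPow_of_nonpos a (Int.add_one_le_iff.2 hm)]
  · rw [intClass_of_nonneg a hm hx, grClass_eq_zero_iff, intPow, Int.toNat_add hm zero_le_one]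
    rfl

theorem intClass_add {m : ℤ} {x y : R} (hx : x ∈ intPow a m) (hy : y ∈ intPow a m) :
    intClass a m (x + y) = intClass a m x + intClass a m y := by
  rcases lt_or_ge m 0 with hm | hm
  · simp [intClass_of_neg a hm]
  · rw [intClass_of_nonneg a hm hx, intClass_of_nonneg a hm hy,
      intClass_of_nonneg a hm (add_mem hx hy)]
    simp only [grClass]
    rw [← map_add, ← map_add]
    rfl

theorem intClass_zero (m : ℤ) : intClass a m 0 = 0 :=
  (intClass_eq_zero_iff a (zero_mem _)).2 (zero_mem _)

theorem intClass_sub {m : ℤ} {x y : R} (hx : x ∈ intPow a m) (hy : y ∈ intPow a m) :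
    intClass a m (x - y) = intClass a m x - intClass a m y := by
  rw [eq_sub_iff_add_eq, ← intClass_add a (sub_mem hx hy) hy, sub_add_cancel]

theorem intClass_eq_iff {m : ℤ} {x y : R} (hx : x ∈ intPow a m) (hy : y ∈ intPow a m) :
    intClass a m x = intClass a m y ↔ x - y ∈ intPow a (m + 1) := by
  rw [← sub_eq_zero, ← intClass_sub a hx hy, intClass_eq_zero_iff a (sub_mem hx hy)]

theorem intClass_sum {ι : Type*} (s : Finset ι) {m : ℤ} {x : ι → R}
    (hx : ∀ i ∈ s, x i ∈ intPow a m) :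
    intClass a m (∑ i ∈ s, x i) = ∑ i ∈ s, intClass a m (x i) := by
  classical
  induction s using Finset.induction_on with
  | empty => simp [intClass_zero]
  | insert i s hi ih =>
    have hs : ∀ j ∈ s, x j ∈ intPow a m := fun j hj => hx j (Finset.mem_insert_of_mem hj)
    rw [Finset.sum_insert hi, Finset.sum_insert hi,
      intClass_add a (hx i (Finset.mem_insert_self i s)) (sum_mem hs), ih hs]

theorem intClass_mul {i j : ℤ} {x y : R} (hx : x ∈ intPow a i) (hy : y ∈ intPow a j) :
    intClass a i x * intClass a j y = intClass a (i + j) (x * y) := by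
  rcases lt_or_ge i 0 with hi | hi
  · rw [intClass_of_neg a hi, zero_mul, eq_comm, intClass_eq_zero_iff a (mul_mem_intPow a hx hy)]
    -- As `i < 0`, the exponent `i + j + 1` is at most `j`, so the factor `y` alone already puts the
    -- product in that power.
    exact intPow_antitone a (by lia) (Ideal.mul_mem_left _ x hy)
  rcases lt_or_ge j 0 with hj | hj
  · rw [intClass_of_neg a hj, mul_zero, eq_comm, intClass_eq_zero_iff a (mul_mem_intPow a hx hy)]
    exact intPow_antitone a (by lia) (Ideal.mul_mem_right y _ hx)
  rw [intClass_of_nonneg a hi hx, intClass_of_nonneg a hj hy, grClass_mul,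
    intClass_of_nonneg a (add_nonneg hi hj) (mul_mem_intPow a hx hy)]
  exact grClass_congr a (Int.toNat_add hi hj).symm _ _ rfl

theorem intClass_apply_of_ne {m : ℤ} {n : ℕ} (h : (n : ℤ) ≠ m) (x : R) :
    intClass a m x n = 0 := by
  unfold intClass
  split_ifs with hm
  · exact DirectSum.of_eq_of_ne _ _ _ (by lia)
  · rfl

/-- The homogeneous component of degree `m` of an element of `Gr_𝔞(R)`, for an integer `m`. -/
def homogComp (m : ℤ) : AssocGr a →+ AssocGr a :=
  if 0 ≤ m then
    (DirectSum.of (GrPiece a) m.toNat).comp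
      (DFinsupp.evalAddMonoidHom (β := GrPiece a) m.toNat)
  else 0

theorem homogComp_intClass (m n : ℤ) (x : R) :
    homogComp a m (intClass a n x) = if m = n then intClass a n x else 0 := by
  unfold homogComp
  split_ifs with hm h h
  · subst h
    change DirectSum.of (GrPiece a) m.toNat (intClass a m x m.toNat) = _
    unfold intClass
    split_ifs with hx
    · exact congrArg _ (DirectSum.of_eq_same _ _)
    · exact map_zero _
  · change DirectSum.of (GrPiece a) m.toNat (intClass a n x m.toNat) = _
    rw [intClass_apply_of_ne a (by lia), map_zero]
  · subst h
    exact (intClass_of_neg a (not_le.1 hm) x).symm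
  · rfl

theorem exists_intClass_eq_of (n : ℕ) (y : GrPiece a n) :
    ∃ x ∈ intPow a n, intClass a n x = DirectSum.of (GrPiece a) n y := by
  obtain ⟨x, rfl⟩ := GrPiece.mk_surjective a n y
  exact ⟨x, (mem_intPow_natCast a).2 x.2, intClass_natCast a n x⟩

/-- Every element of `Gr_𝔞(R)` is a sum of classes. -/
theorem assocGr_induction {P : AssocGr a → Prop} (h0 : P 0)
    (hc : ∀ (n : ℤ) (x : R), x ∈ intPow a n → P (intClass a n x))
    (hadd : ∀ f g, P f → P g → P (f + g)) (f : AssocGr a) : P f := by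
  induction f using DirectSum.induction_on with
  | zero => exact h0
  | of n y =>
    obtain ⟨x, hx, hxy⟩ := exists_intClass_eq_of a n y
    exact hxy ▸ hc n x hx
  | add f g hf hg => exact hadd f g hf hg

theorem homogComp_eq_intClass (m : ℤ) (f : AssocGr a) :
    ∃ x ∈ intPow a m, homogComp a m f = intClass a m x := by
  induction f using assocGr_induction with
  | h0 => exact ⟨0, zero_mem _, by rw [map_zero, intClass_zero]⟩
  | hc n x hx =>
    rw [homogComp_intClass]
    split_ifs with h
    · exact ⟨x, h ▸ hx, by rw [h]⟩
    · exact ⟨0, zero_mem _, by rw [intClass_zero]⟩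
  | hadd f g hf hg =>
    obtain ⟨x, hx, hfx⟩ := hf
    obtain ⟨y, hy, hgy⟩ := hg
    exact ⟨x + y, add_mem hx hy, by rw [map_add, hfx, hgy, intClass_add a hx hy]⟩

theorem homogComp_eq_self {m : ℤ} {f : AssocGr a} (hf : ∀ n : ℕ, (n : ℤ) ≠ m → f n = 0) :
    homogComp a m f = f := by
  refine DFinsupp.ext fun n => ?_
  unfold homogComp
  split_ifs with hm
  · change DirectSum.of (GrPiece a) m.toNat (f m.toNat) n = f n
    by_cases h : n = m.toNat
    · subst h
      exact DirectSum.of_eq_same _ _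
    · rw [DirectSum.of_eq_of_ne _ _ _ h, hf n (by lia)]
  · exact (hf n (by lia)).symm

theorem homogComp_mul_intClass (m n : ℤ) (f : AssocGr a) {y : R} (hy : y ∈ intPow a n) :
    homogComp a m (f * intClass a n y) = homogComp a (m - n) f * intClass a n y := by
  induction f using assocGr_induction with
  | h0 => simp
  | hc i x hx =>
    rw [intClass_mul a hx hy, homogComp_intClass, homogComp_intClass]
    by_cases h : m = i + n
    · rw [if_pos h, if_pos (by lia), intClass_mul a hx hy]
    · rw [if_neg h, if_neg (by lia), zero_mul]
  | hadd f g hf hg => rw [add_mul, map_add, map_add, hf, hg, add_mul]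

theorem homogComp_mul {m n : ℤ} (f : AssocGr a) {v : AssocGr a}
    (hv : ∀ i : ℕ, (i : ℤ) ≠ n → v i = 0) :
    homogComp a m (f * v) = homogComp a (m - n) f * v := by
  obtain ⟨y, hy, h⟩ := homogComp_eq_intClass a n v
  rw [homogComp_eq_self a hv] at h
  rw [h, homogComp_mul_intClass a m n f hy]

/-! ### Initial forms and the initial ideal -/

theorem initForm_eq {c : R} {n : ℕ} (h₁ : c ∈ a ^ n) (h₂ : c ∉ a ^ (n + 1)) :
    initForm a c = grClass a n ⟨c, h₁⟩ := by
  have h : ∃ n : ℕ, c ∈ a ^ n ∧ c ∉ a ^ (n + 1) := ⟨n, h₁, h₂⟩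
  have hn : h.choose = n := by
    apply le_antisymm
    · by_contra! hlt
      exact h₂ (Ideal.pow_le_pow_right hlt h.choose_spec.1)
    · by_contra! hlt
      exact h.choose_spec.2 (Ideal.pow_le_pow_right hlt h₁)
  rw [initForm, dif_pos h]
  exact grClass_congr a hn _ _ rfl

theorem initForm_zero : initForm a 0 = 0 :=
  dif_neg fun ⟨_, h⟩ => h.2 (zero_mem _)

/-- If the class in degree `m` vanished for a nonzero `c`, then `c` could have a nonzero initial
form in a higher degree; `h0` excludes this. -/
theorem initForm_eq_intClass {c : R} {m : ℤ} (hc : c ∈ intPow a m)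
    (h0 : intClass a m c = 0 → c = 0) : initForm a c = intClass a m c := by
  by_cases h : intClass a m c = 0
  · rw [h, h0 h, initForm_zero]
  · have hm : 0 ≤ m := by
      by_contra! hm
      exact h (intClass_of_neg a hm c)
    lift m to ℕ using hm
    have hc' := (mem_intPow_natCast a).1 hc
    rw [intClass_eq_zero_iff a hc] at h
    have h' : c ∉ a ^ (m + 1) := fun h' => h ((mem_intPow_natCast a (n := m + 1)).2 h')
    rw [initForm_eq a hc' h', ← intClass_natCast]

theorem intClass_mem_initIdeal {I : Ideal R} {m : ℤ} {c : R} (hc : c ∈ I) (hm : c ∈ intPow a m) :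
    intClass a m c ∈ initIdeal a I := by
  by_cases h : intClass a m c = 0
  · rw [h]
    exact zero_mem _
  · rw [← initForm_eq_intClass a hm fun h' => absurd h' h]
    exact Ideal.subset_span ⟨c, hc, rfl⟩

/-- The homogeneous components of the elements of `in_𝔞(I)` are classes of elements of `I`. -/
theorem exists_homogComp_eq_of_mem_initIdeal {I : Ideal R} {f : AssocGr a}
    (hf : f ∈ initIdeal a I) (m : ℤ) :
    ∃ c ∈ I, c ∈ intPow a m ∧ homogComp a m f = intClass a m c := by
  unfold initIdeal at hf
  induction hf using Submodule.span_induction generalizing m with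
  | mem f hf =>
    obtain ⟨c, hc, rfl⟩ := hf
    by_cases h : ∃ n : ℕ, c ∈ a ^ n ∧ c ∉ a ^ (n + 1)
    · obtain ⟨n, h₁, h₂⟩ := h
      rw [initForm_eq a h₁ h₂, ← intClass_natCast, homogComp_intClass]
      split_ifs with hmn
      · exact ⟨c, hc, hmn ▸ (mem_intPow_natCast a).2 h₁, by rw [hmn]⟩
      · exact ⟨0, zero_mem _, zero_mem _, (intClass_zero a m).symm⟩
    · rw [initForm, dif_neg h]
      exact ⟨0, zero_mem _, zero_mem _, by rw [map_zero, intClass_zero]⟩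
  | zero => exact ⟨0, zero_mem _, zero_mem _, by rw [map_zero, intClass_zero]⟩
  | add f g _ _ hf hg =>
    obtain ⟨x, hxI, hx, hfx⟩ := hf m
    obtain ⟨y, hyI, hy, hgy⟩ := hg m
    exact ⟨x + y, add_mem hxI hyI, add_mem hx hy,
      by rw [map_add, hfx, hgy, intClass_add a hx hy]⟩
  | smul g f _ hf =>
    induction g using assocGr_induction with
    | h0 => exact ⟨0, zero_mem _, zero_mem _, by rw [zero_smul, map_zero, intClass_zero]⟩
    | hc i x hx =>
      -- Multiplication by a class of degree `i` raises degrees by `i`, so the component of degree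
      -- `m` comes from that of degree `m - i`.
      obtain ⟨c, hcI, hc, hfc⟩ := hf (m - i)
      have hm : m - i + i = m := sub_add_cancel m i
      refine ⟨c * x, Ideal.mul_mem_right x I hcI, hm ▸ mul_mem_intPow a hc hx, ?_⟩
      rw [smul_eq_mul, mul_comm, homogComp_mul_intClass a m i f hx, hfc, intClass_mul a hc hx, hm]
    | hadd g g' hg hg' =>
      obtain ⟨x, hxI, hx, hfx⟩ := hg
      obtain ⟨y, hyI, hy, hgy⟩ := hg'
      exact ⟨x + y, add_mem hxI hyI, add_mem hx hy,
        by rw [add_smul, map_add, hfx, hgy, intClass_add a hx hy]⟩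

theorem grClass_mem_initIdeal_iff (I : Ideal R) (n : ℕ) (x : ↥(a ^ n)) :
    grClass a n x ∈ initIdeal a I ↔ (x : R) ∈ I ⊔ a ^ (n + 1) := by
  have hx : (x : R) ∈ intPow a n := (mem_intPow_natCast a).2 x.2
  rw [← intClass_natCast]
  constructor
  · intro h
    obtain ⟨c, hcI, hc, h⟩ := exists_homogComp_eq_of_mem_initIdeal a h n
    rw [homogComp_intClass, if_pos rfl, intClass_eq_iff a hx hc] at h
    rw [← add_sub_cancel c (x : R)]
    exact Submodule.add_mem_sup hcI ((mem_intPow_natCast a (n := n + 1)).1 h)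
  · intro h
    obtain ⟨c, hcI, y, hy, h⟩ := Submodule.mem_sup.1 h
    have hc : c ∈ intPow a n := by
      rw [eq_sub_of_add_eq h]
      exact sub_mem hx ((mem_intPow_natCast a).2 (Ideal.pow_le_pow_right n.le_succ hy))
    rw [(intClass_eq_iff a hx hc).2]
    · exact intClass_mem_initIdeal a hcI hc
    · rw [← h, add_sub_cancel_left]
      exact (mem_intPow_natCast a (n := n + 1)).2 hy

end IntegerDegrees

/-! ### Filtered free modules and the lifting of one map -/

section Lifting

theorem apply_eq_sum_single {S M : Type*} [CommRing S] [AddCommGroup M] [Module S M] {r : ℕ}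
    (f : (Fin r → S) →ₗ[S] M) (x : Fin r → S) : f x = ∑ i, x i • f (Pi.single i 1) := by
  conv_lhs => rw [pi_eq_sum_univ' x, map_sum]
  simp only [map_smul]

variable {R : Type*} [CommRing R] (a : Ideal R) {r r' : ℕ} (d : Fin r → ℤ) (d' : Fin r' → ℤ)

theorem mem_vecFilt_iff {m : ℤ} {g : Fin r → R} :
    g ∈ vecFilt a d m ↔ ∀ i, g i ∈ intPow a (m - d i) := by
  simp [vecFilt, intPow]

theorem vecFilt_antitone : Antitone (vecFilt a d) := fun _ _ h _ hg =>
  (mem_vecFilt_iff a d).2 fun i => intPow_antitone a (by lia) ((mem_vecFilt_iff a d).1 hg i)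

/-- The class in degree `m` of `⨁ᵢ Gr_𝔞(R)(-dᵢ)` of an element of `⨁ᵢ R(-dᵢ)`. -/
def vecIntClass (m : ℤ) (g : Fin r → R) : Fin r → AssocGr a := fun i => intClass a (m - d i) (g i)

theorem vecClass_eq_vecIntClass (m : ℤ) (x : ↥(vecFilt a d m)) :
    vecClass a d m x = vecIntClass a d m x.1 := by
  funext i
  unfold vecClass vecIntClass
  split_ifs with h
  · exact (intClass_of_nonneg a h _).symm
  · exact (intClass_of_neg a (not_le.1 h) _).symm

theorem vecIntClass_zero (m : ℤ) : vecIntClass a d m 0 = 0 := funext fun _ => intClass_zero a _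

theorem vecIntClass_eq_iff {m : ℤ} {g h : Fin r → R} (hg : g ∈ vecFilt a d m)
    (hh : h ∈ vecFilt a d m) :
    vecIntClass a d m g = vecIntClass a d m h ↔ g - h ∈ vecFilt a d (m + 1) := by
  rw [mem_vecFilt_iff] at *
  rw [funext_iff]
  refine forall_congr' fun i => ?_
  rw [vecIntClass, vecIntClass, intClass_eq_iff a (hg i) (hh i), Pi.sub_apply]
  congr! 2
  ring

theorem vecIntClass_eq_zero_iff {m : ℤ} {g : Fin r → R} (hg : g ∈ vecFilt a d m) :
    vecIntClass a d m g = 0 ↔ g ∈ vecFilt a d (m + 1) := by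
  rw [← vecIntClass_zero a d m, vecIntClass_eq_iff a d hg (zero_mem _), sub_zero]

theorem exists_vecIntClass_eq {m : ℤ} {v : Fin r → AssocGr a} (hv : IsHomogVec a d m v) :
    ∃ g ∈ vecFilt a d m, vecIntClass a d m g = v := by
  choose g hg h using fun i => homogComp_eq_intClass a (m - d i) (v i)
  refine ⟨g, (mem_vecFilt_iff a d).2 hg, funext fun i => ?_⟩
  rw [vecIntClass, ← h i, homogComp_eq_self a (hv i)]

theorem isHomogVec_vecIntClass (m : ℤ) (g : Fin r → R) :
    IsHomogVec a d m (vecIntClass a d m g) :=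
  fun _ _ h => intClass_apply_of_ne a h _

theorem vecInitForm_eq_vecIntClass {m : ℤ} {g : Fin r → R} (hg : g ∈ vecFilt a d m)
    (h0 : vecIntClass a d m g = 0 → g = 0) : vecInitForm a d g = vecIntClass a d m g := by
  by_cases h : vecIntClass a d m g = 0
  · rw [h, h0 h]
    exact dif_neg fun ⟨_, h⟩ => h.2 (zero_mem _)
  · rw [vecIntClass_eq_zero_iff a d hg] at h
    have hex : ∃ m : ℤ, g ∈ vecFilt a d m ∧ g ∉ vecFilt a d (m + 1) := ⟨m, hg, h⟩
    have hm : hex.choose = m := by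
      apply le_antisymm
      · by_contra! hlt
        exact h (vecFilt_antitone a d hlt hex.choose_spec.1)
      · by_contra! hlt
        exact hex.choose_spec.2 (vecFilt_antitone a d hlt hg)
    rw [vecInitForm, dif_pos hex, vecClass_eq_vecIntClass]
    exact congrArg (vecIntClass a d · g) hm

/-- A linear map that lifts a homogeneous one on basis vectors lifts it on all of the filtration. -/
theorem map_vecFilt_of_basis {δ : (Fin r' → R) →ₗ[R] (Fin r → R)}
    {φ : (Fin r' → AssocGr a) →ₗ[AssocGr a] (Fin r → AssocGr a)}
    (hδ : ∀ i, δ (Pi.single i 1) ∈ vecFilt a d (d' i))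
    (hφ : ∀ i, vecIntClass a d (d' i) (δ (Pi.single i 1)) = φ (Pi.single i 1))
    {m : ℤ} {x : Fin r' → R} (hx : x ∈ vecFilt a d' m) :
    δ x ∈ vecFilt a d m ∧ vecIntClass a d m (δ x) = φ (vecIntClass a d' m x) := by
  simp only [mem_vecFilt_iff] at *
  -- The shifts of the source cancel: `(m - d' i) + (d' i - d j) = m - d j`.
  have hmem : ∀ i j, x i * δ (Pi.single i 1) j ∈ intPow a (m - d j) := fun i j => by
    have h := mul_mem_intPow a (hx i) (hδ i j)
    rwa [sub_add_sub_cancel] at h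
  have hsum : ∀ j, δ x j = ∑ i, x i * δ (Pi.single i 1) j := fun j => by
    rw [apply_eq_sum_single δ x]
    simp
  refine ⟨fun j => ?_, funext fun j => ?_⟩
  · rw [hsum]
    exact sum_mem fun i _ => hmem i j
  · rw [vecIntClass, hsum, intClass_sum a _ fun i _ => hmem i j,
      apply_eq_sum_single φ, Finset.sum_apply]
    refine Finset.sum_congr rfl fun i _ => ?_
    rw [Pi.smul_apply, smul_eq_mul, ← hφ i, vecIntClass, vecIntClass,
      intClass_mul a (hx i) (hδ i j), sub_add_sub_cancel]

/-- An element of the image of a homogeneous map that is homogeneous is the image of a homogeneous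
element. -/
theorem exists_homog_preimage {φ : (Fin r' → AssocGr a) →ₗ[AssocGr a] (Fin r → AssocGr a)}
    (hφ : ∀ i, IsHomogVec a d (d' i) (φ (Pi.single i 1))) {m : ℤ} {v : Fin r → AssocGr a}
    (hv : IsHomogVec a d m v) (h : v ∈ LinearMap.range φ) :
    ∃ w, IsHomogVec a d' m w ∧ φ w = v := by
  obtain ⟨w, rfl⟩ := h
  -- Keep only the part of `w` of total degree `m`. Since `φ` is homogeneous, the discarded
  -- components do not contribute to degree `m` of the image.
  refine ⟨fun i => homogComp a (m - d' i) (w i), fun i n hn => ?_, funext fun j => ?_⟩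
  · obtain ⟨x, -, hx⟩ := homogComp_eq_intClass a (m - d' i) (w i)
    change homogComp a (m - d' i) (w i) n = 0
    rw [hx, intClass_apply_of_ne a hn]
  · rw [← homogComp_eq_self a (hv j), apply_eq_sum_single φ w, apply_eq_sum_single φ,
      Finset.sum_apply, Finset.sum_apply, map_sum]
    refine Finset.sum_congr rfl fun i _ => ?_
    rw [Pi.smul_apply, Pi.smul_apply, smul_eq_mul, smul_eq_mul, homogComp_mul a _ (hφ i j),
      sub_sub_sub_cancel_right]

/-- The homogeneous elements of `K'` are the classes of the elements of `K`. -/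
structure IsInitSubmodule (K : Submodule R (Fin r → R))
    (K' : Submodule (AssocGr a) (Fin r → AssocGr a)) : Prop where
  lift : ∀ {m : ℤ} {v : Fin r → AssocGr a}, IsHomogVec a d m v → v ∈ K' →
    ∃ g ∈ K, g ∈ vecFilt a d m ∧ vecIntClass a d m g = v
  vecIntClass_mem : ∀ {m : ℤ} {g : Fin r → R}, g ∈ K → g ∈ vecFilt a d m →
    vecIntClass a d m g ∈ K'

/-- The finitely many shifts are bounded by `∑ |dᵢ|`, so the filtration is fine enough for Krull's
theorem on the `𝔞`-adic topology to apply. -/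
theorem vecFilt_le_pow_smul_top (n : ℕ) :
    ∃ q : ℤ, vecFilt a d q ≤ a ^ n • (⊤ : Submodule R (Fin r → R)) := by
  refine ⟨n + ∑ i, |d i|, fun g hg => ?_⟩
  rw [pi_eq_sum_univ' g]
  refine sum_mem fun i _ => Submodule.smul_mem_smul ?_ trivial
  refine (mem_intPow_natCast a).1 (intPow_antitone a ?_ ((mem_vecFilt_iff a d).1 hg i))
  have := Finset.single_le_sum (f := fun i => |d i|) (fun i _ => abs_nonneg _) (Finset.mem_univ i)
  have := le_abs_self (d i)
  lia

theorem exists_mem_vecFilt (g : Fin r → R) : ∃ q : ℤ, g ∈ vecFilt a d q := by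
  refine ⟨-∑ i, |d i|, (mem_vecFilt_iff a d).2 fun i => mem_intPow_of_nonpos a ?_ _⟩
  have := Finset.single_le_sum (f := fun i => |d i|) (fun i _ => abs_nonneg _) (Finset.mem_univ i)
  have := neg_le_abs (d i)
  lia

variable [IsNoetherianRing R] [IsLocalRing R]

/-- Submodules of `⨁ᵢ R(-dᵢ)` are closed in the topology of the filtration. -/
theorem mem_of_forall_mem_sup_vecFilt (ha : a ≠ ⊤) {N : Submodule R (Fin r → R)} {y : Fin r → R}
    (h : ∀ q : ℤ, y ∈ N ⊔ vecFilt a d q) : y ∈ N := by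
  -- Krull's intersection theorem for the finite module `Rʳ/N`: the class of `y` lies in every
  -- `𝔞ⁿ(Rʳ/N)`.
  rw [← Submodule.Quotient.mk_eq_zero, ← Submodule.mem_bot R,
    ← Ideal.iInf_pow_smul_eq_bot_of_isLocalRing (M := (Fin r → R) ⧸ N) a ha, Submodule.mem_iInf]
  intro n
  obtain ⟨q, hq⟩ := vecFilt_le_pow_smul_top a d n
  obtain ⟨z, hz, g, hg, rfl⟩ := Submodule.mem_sup.1 (h q)
  rw [Submodule.Quotient.mk_add, (Submodule.Quotient.mk_eq_zero N).2 hz, zero_add]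
  have := Submodule.mem_map_of_mem (f := N.mkQ) (hq hg)
  rw [Submodule.map_smul''] at this
  exact Submodule.smul_mono le_rfl le_top this

/-- A homogeneous map onto the initial submodule of `K` lifts to a filtered map onto `K`, and the
kernel of the former is the initial submodule of the kernel of the latter. -/
theorem exists_lift (ha : a ≠ ⊤) {K : Submodule R (Fin r → R)}
    {K' : Submodule (AssocGr a) (Fin r → AssocGr a)} (hK : IsInitSubmodule a d K K')
    {φ : (Fin r' → AssocGr a) →ₗ[AssocGr a] (Fin r → AssocGr a)}
    (hφ : ∀ i, IsHomogVec a d (d' i) (φ (Pi.single i 1))) (hrange : LinearMap.range φ = K') :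
    ∃ δ : (Fin r' → R) →ₗ[R] (Fin r → R), LinearMap.range δ = K ∧
      (∀ {m : ℤ} {x : Fin r' → R}, x ∈ vecFilt a d' m →
        δ x ∈ vecFilt a d m ∧ vecIntClass a d m (δ x) = φ (vecIntClass a d' m x)) ∧
      (∀ i, δ (Pi.single i 1) ∈ vecFilt a d (d' i) ∧
        vecIntClass a d (d' i) (δ (Pi.single i 1)) = φ (Pi.single i 1) ∧
        (φ (Pi.single i 1) = 0 → δ (Pi.single i 1) = 0)) ∧
      IsInitSubmodule a d' (LinearMap.ker δ) (LinearMap.ker φ) := by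
  have hu : ∀ i, ∃ u ∈ K, u ∈ vecFilt a d (d' i) ∧
      vecIntClass a d (d' i) u = φ (Pi.single i 1) ∧ (φ (Pi.single i 1) = 0 → u = 0) := by
    intro i
    -- When `φ(eᵢ) = 0` the lift must be `0` itself: a nonzero lift could have a nonzero initial
    -- form in higher degree.
    by_cases h : φ (Pi.single i 1) = 0
    · exact ⟨0, zero_mem _, zero_mem _, by rw [h, vecIntClass_zero], fun _ => rfl⟩
    · obtain ⟨u, h₁, h₂, h₃⟩ := hK.lift (hφ i) (hrange ▸ LinearMap.mem_range_self φ _)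
      exact ⟨u, h₁, h₂, h₃, fun h' => absurd h' h⟩
  choose u huK hud huφ hu0 using hu
  let δ : (Fin r' → R) →ₗ[R] (Fin r → R) := Fintype.linearCombination R u
  have hδ : ∀ i, δ (Pi.single i 1) = u i := fun i => by
    simp [δ, Fintype.linearCombination_apply_single]
  have hmap : ∀ {m : ℤ} {x : Fin r' → R}, x ∈ vecFilt a d' m →
      δ x ∈ vecFilt a d m ∧ vecIntClass a d m (δ x) = φ (vecIntClass a d' m x) := fun hx =>
    map_vecFilt_of_basis a d d' (fun i => by rw [hδ]; exact hud i)
      (fun i => by rw [hδ]; exact huφ i) hx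
  have hδK : ∀ x, δ x ∈ K := fun x => by
    rw [apply_eq_sum_single δ x]
    exact sum_mem fun i _ => K.smul_mem _ (by rw [hδ]; exact huK i)
  have happrox : ∀ {p : ℤ} {y : Fin r → R}, y ∈ K → y ∈ vecFilt a d p →
      ∃ z ∈ vecFilt a d' p, y - δ z ∈ vecFilt a d (p + 1) := by
    intro p y hyK hy
    obtain ⟨w, hw, hwy⟩ := exists_homog_preimage a d d' hφ (isHomogVec_vecIntClass a d p y)
      (hrange ▸ hK.vecIntClass_mem hyK hy)
    obtain ⟨z, hz, rfl⟩ := exists_vecIntClass_eq a d' hw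
    refine ⟨z, hz, ?_⟩
    rw [← vecIntClass_eq_iff a d hy (hmap hz).1, (hmap hz).2, hwy]
  -- Strictness: `K ∩ Fᵖ` is contained in `δ(Fᵖ)`. Each correction `z'` lies in `Fᵖ⁺ⁿ`, so the
  -- preimages stay in `Fᵖ`; closedness of the submodule `δ(Fᵖ)` replaces the passage to a limit.
  have hstrict : ∀ {p : ℤ} {y : Fin r → R}, y ∈ K → y ∈ vecFilt a d p →
      ∃ z ∈ vecFilt a d' p, δ z = y := by
    intro p y hyK hy
    have hn : ∀ n : ℕ, ∃ z ∈ vecFilt a d' p, y - δ z ∈ vecFilt a d (p + n) := by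
      intro n
      induction n with
      | zero => exact ⟨0, zero_mem _, by simpa using hy⟩
      | succ n ih =>
        obtain ⟨z, hz, hyz⟩ := ih
        obtain ⟨z', hz', hyz'⟩ := happrox (sub_mem hyK (hδK z)) hyz
        refine ⟨z + z', add_mem hz (vecFilt_antitone a d' (by lia) hz'), ?_⟩
        rw [map_add, ← sub_sub]
        simpa [add_assoc] using hyz'
    refine Submodule.mem_map.1 (mem_of_forall_mem_sup_vecFilt a d ha fun q => ?_)
    obtain ⟨z, hz, hyz⟩ := hn (q - p).toNat
    rw [← add_sub_cancel (δ z) y]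
    exact Submodule.add_mem_sup (Submodule.mem_map_of_mem hz)
      (vecFilt_antitone a d (by lia) hyz)
  refine ⟨δ, le_antisymm ?_ fun y hy => ?_, hmap, fun i => ?_, ?_, ?_⟩
  · rintro _ ⟨x, rfl⟩
    exact hδK x
  · obtain ⟨q, hq⟩ := exists_mem_vecFilt a d y
    obtain ⟨z, -, hz⟩ := hstrict hy hq
    exact ⟨z, hz⟩
  · rw [hδ]
    exact ⟨hud i, huφ i, hu0 i⟩
  · intro m v hv hφv
    obtain ⟨g, hg, rfl⟩ := exists_vecIntClass_eq a d' hv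
    have h := (hmap hg).2
    rw [LinearMap.mem_ker.1 hφv, vecIntClass_eq_zero_iff a d (hmap hg).1] at h
    -- `δ g` has order at least `m + 1`, so by strictness `δ g = δ z` with `z ∈ Fᵐ⁺¹`. Then `g - z`
    -- is in the kernel and has the class of `g`.
    obtain ⟨z, hz, hδz⟩ := hstrict (hδK g) h
    have hz' := vecFilt_antitone a d' (Int.le_add_one le_rfl) hz
    refine ⟨g - z, by rw [LinearMap.mem_ker, map_sub, hδz, sub_self], sub_mem hg hz', ?_⟩
    rw [vecIntClass_eq_iff a d' (sub_mem hg hz') hg, sub_sub_cancel_left]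
    exact neg_mem hz
  · intro m g hg hgm
    rw [LinearMap.mem_ker, ← (hmap hgm).2, LinearMap.mem_ker.1 hg, vecIntClass_zero]

end Lifting

/-! ### Regular local rings and the syzygy theorem -/

section RegularLocalRing

open IsLocalRing

universe u

/-- An exchange argument: when `x` is written in minimal generators of `𝔪`, some coefficient is a
unit because `x ∉ 𝔪²`, and `x` can replace that generator. -/
theorem exists_finset_span_insert_eq_maximalIdeal {R : Type*} [CommRing R] [IsLocalRing R]
    [IsNoetherianRing R] {x : R} (hx : x ∈ maximalIdeal R) (hx2 : x ∉ maximalIdeal R ^ 2) :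
    ∃ s : Finset R, s.card + 1 ≤ (maximalIdeal R).spanFinrank ∧
      maximalIdeal R = Ideal.span {x} ⊔ Ideal.span (s : Set R) := by
  classical
  obtain ⟨t, ht, hspan⟩ :=
    Submodule.FG.exists_span_finset_card_eq_spanFinrank (maximalIdeal R).fg_of_isNoetherianRing
  have hxt : x ∈ Submodule.span R (t : Set R) := hspan ▸ hx
  obtain ⟨c, -, hc⟩ := Submodule.mem_span_finset.1 hxt
  have htm : ∀ y ∈ t, y ∈ maximalIdeal R := fun y hy => hspan ▸ Submodule.subset_span hy
  obtain ⟨y, hy, hcy⟩ : ∃ y ∈ t, IsUnit (c y) := by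
    by_contra! h
    refine hx2 (hc ▸ sum_mem fun y hy => ?_)
    rw [pow_two]
    exact Ideal.mul_mem_mul ((mem_maximalIdeal _).2 (h y hy)) (htm y hy)
  refine ⟨t.erase y, ?_, le_antisymm ?_ ?_⟩
  · rw [Finset.card_erase_add_one hy, ht]
  · rw [← hspan, Submodule.span_le]
    intro z hz
    have hle : Ideal.span ((t.erase y : Finset R) : Set R) ≤
        Ideal.span {x} ⊔ Ideal.span ((t.erase y : Finset R) : Set R) := le_sup_right
    by_cases hzy : z = y
    · subst hzy
      rw [← Finset.add_sum_erase t _ hy] at hc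
      have hcz : c z * z ∈ Ideal.span {x} ⊔ Ideal.span ((t.erase z : Finset R) : Set R) := by
        have : c z * z = x - ∑ w ∈ t.erase z, c w • w := by
          rw [← hc, add_sub_cancel_right, smul_eq_mul]
        rw [this]
        exact sub_mem (Ideal.mem_sup_left (Ideal.mem_span_singleton_self x))
          (hle (sum_mem fun w hw => Ideal.mul_mem_left _ _ (Ideal.subset_span hw)))
      exact (Ideal.unit_mul_mem_iff_mem _ hcy).1 hcz
    · exact hle (Ideal.subset_span (Finset.mem_erase.2 ⟨hzy, hz⟩))
  · refine sup_le ((Ideal.span_singleton_le_iff_mem _).2 hx) (Ideal.span_le.2 fun z hz => ?_)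
    exact htm z (Finset.mem_of_mem_erase hz)

/-- The quotient of a regular local ring by an element of `𝔪 \ 𝔪²` is regular. -/
theorem isRegularLocalRing_quotient_span_singleton {R : Type*} [CommRing R] [IsRegularLocalRing R]
    {x : R} (hx : x ∈ maximalIdeal R) (hx2 : x ∉ maximalIdeal R ^ 2) :
    ∃ _ : IsRegularLocalRing (R ⧸ Ideal.span {x}),
      (maximalIdeal (R ⧸ Ideal.span {x})).spanFinrank + 1 ≤ (maximalIdeal R).spanFinrank := by
  classical
  have hne : Ideal.span {x} ≠ ⊤ := fun h =>
    (mem_maximalIdeal x).1 hx (Ideal.span_singleton_eq_top.1 h)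
  have : Nontrivial (R ⧸ Ideal.span {x}) := Ideal.Quotient.nontrivial_iff.2 hne
  have : IsLocalRing (R ⧸ Ideal.span {x}) :=
    .of_surjective' (Ideal.Quotient.mk (Ideal.span {x})) Ideal.Quotient.mk_surjective
  obtain ⟨s, hs, hm⟩ := exists_finset_span_insert_eq_maximalIdeal hx hx2
  have hmap : maximalIdeal (R ⧸ Ideal.span {x}) =
      Ideal.span (Ideal.Quotient.mk (Ideal.span {x}) '' (s : Set R)) := by
    have h := map_maximalIdeal_of_surjective (Ideal.Quotient.mk (Ideal.span {x}))
      Ideal.Quotient.mk_surjective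
    rw [← h, hm, Ideal.map_sup, Ideal.map_quotient_self, bot_sup_eq, Ideal.map_span]
  have hle : (maximalIdeal (R ⧸ Ideal.span {x})).spanFinrank ≤ s.card := by
    rw [hmap]
    refine (Submodule.spanFinrank_span_le_ncard_of_finite (s.finite_toSet.image _)).trans ?_
    exact (Set.ncard_image_le s.finite_toSet).trans (Set.ncard_coe_finset s).le
  have hle' : (maximalIdeal (R ⧸ Ideal.span {x})).spanFinrank + 1 ≤
      (maximalIdeal R).spanFinrank := (Nat.add_le_add_right hle 1).trans hs
  refine ⟨.of_spanFinrank_maximalIdeal_le _ ?_, hle'⟩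
  -- The dimension drops by at most one while the embedding dimension drops by at least one, so the
  -- latter is at most the former for `R/x`.
  have hdim := Ideal.height_le_ringKrullDim_quotient_add_one (p := maximalIdeal R) hx
  rw [maximalIdeal_height_eq_ringKrullDim, ← IsRegularLocalRing.spanFinrank_maximalIdeal] at hdim
  rw [← ENat.WithBot.add_le_add_natCast_right_iff (c := 1)]
  refine le_trans ?_ hdim
  exact_mod_cast hle'

theorem maximalIdeal_eq_bot_of_le_sq {R : Type*} [CommRing R] [IsLocalRing R] [IsNoetherianRing R]
    (h : maximalIdeal R ≤ maximalIdeal R ^ 2) : maximalIdeal R = ⊥ :=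
  Submodule.eq_bot_of_le_smul_of_le_jacobson_bot (maximalIdeal R) _
    (maximalIdeal R).fg_of_isNoetherianRing (by rwa [smul_eq_mul, ← pow_two])
    (maximalIdeal_le_jacobson _)

/-- A regular local ring is a domain. -/
theorem isDomain_of_isRegularLocalRing (R : Type*) [CommRing R] [IsRegularLocalRing R] :
    IsDomain R := by
  classical
  induction hn : (maximalIdeal R).spanFinrank using Nat.strong_induction_on generalizing R with
  | h n ih =>
  by_cases hbot : maximalIdeal R = ⊥
  · exact (isField_iff_maximalIdeal_eq.2 hbot).isDomain
  -- Prime avoidance, with `𝔪²` as the one ideal not assumed prime. By Nakayama `𝔪 ⊄ 𝔪²`, and `𝔪`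
  -- inside a minimal prime would force dimension `0`, hence `𝔪 = 0` by regularity.
  obtain ⟨x, hxm, hx⟩ : ∃ x ∈ maximalIdeal R,
      x ∉ ⋃ i ∈ (↑(insert (maximalIdeal R ^ 2)
        (minimalPrimes.finite_of_isNoetherianRing R).toFinset) : Set (Ideal R)), (i : Set R) := by
    by_contra! h
    obtain ⟨P, hP, hmP⟩ := (Ideal.subset_union_prime (f := id) (maximalIdeal R ^ 2)
      (maximalIdeal R ^ 2) (fun P hP h _ => by
        rw [Finset.mem_insert, or_iff_right h, Set.Finite.mem_toFinset] at hP
        exact hP.1.1)).1 h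
    rw [Finset.mem_insert, Set.Finite.mem_toFinset] at hP
    rcases hP with rfl | hP
    · exact hbot (maximalIdeal_eq_bot_of_le_sq hmP)
    · have hPm : maximalIdeal R = P := le_antisymm hmP (le_maximalIdeal hP.1.1.ne_top)
      rw [← hPm, ← Ideal.height_eq_zero_iff] at hP
      have h0 := IsRegularLocalRing.spanFinrank_maximalIdeal (R := R)
      rw [← maximalIdeal_height_eq_ringKrullDim, hP] at h0
      exact hbot ((Submodule.spanFinrank_eq_zero_iff_eq_bot
        (maximalIdeal R).fg_of_isNoetherianRing).1 (by exact_mod_cast h0))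
  simp only [Finset.coe_insert, Set.Finite.coe_toFinset, Set.mem_insert_iff,
    Set.iUnion_iUnion_eq_or_left, Set.mem_union, SetLike.mem_coe, Set.mem_iUnion, not_or,
    not_exists] at hx
  obtain ⟨hreg, hlt⟩ := isRegularLocalRing_quotient_span_singleton hxm hx.1
  have hdom := ih _ (by lia) (R ⧸ Ideal.span {x}) rfl
  have hprime : (Ideal.span {x}).IsPrime := (Ideal.Quotient.isDomain_iff_prime _).1 hdom
  obtain ⟨P, hP, hPx⟩ := Ideal.exists_minimalPrimes_le (bot_le : ⊥ ≤ Ideal.span {x})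
  have hxP : x ∉ P := hx.2 P hP
  -- `P ⊆ (x)` and `x ∉ P` give `P = xP`, so `P = 0` by Nakayama.
  have hP0 : P = ⊥ := by
    refine Submodule.eq_bot_of_le_smul_of_le_jacobson_bot (Ideal.span {x}) P
      P.fg_of_isNoetherianRing (fun y hy => ?_) ?_
    · obtain ⟨z, rfl⟩ := Ideal.mem_span_singleton'.1 (hPx hy)
      rw [mul_comm]
      exact Ideal.mul_mem_mul (Ideal.mem_span_singleton_self x)
        ((hP.1.1.mem_or_mem hy).resolve_right hxP)
    · exact ((Ideal.span_singleton_le_iff_mem _).2 hxm).trans (maximalIdeal_le_jacobson _)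
  have : (⊥ : Ideal R).IsPrime := hP0 ▸ hP.1.1
  exact IsDomain.of_bot_isPrime R

/-- Every `n`-th syzygy module of `M`, formed with free modules of finite rank, is free. -/
def FreeSyzygy (R : Type u) [CommRing R] :
    ℕ → ∀ (M : Type u) [AddCommGroup M] [Module R M], Prop
  | 0, M, _, _ => Module.Free R M
  | n + 1, M, _, _ => ∀ (k : ℕ) (f : (Fin k → R) →ₗ[R] M), Function.Surjective f →
      FreeSyzygy R n (LinearMap.ker f)

theorem FreeSyzygy.congr {R : Type u} [CommRing R] {n : ℕ} {M N : Type u} [AddCommGroup M]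
    [Module R M] [AddCommGroup N] [Module R N] (e : M ≃ₗ[R] N) (h : FreeSyzygy R n M) :
    FreeSyzygy R n N := by
  cases n with
  | zero =>
    have : Module.Free R M := h
    exact Module.Free.of_equiv e
  | succ n =>
    intro k f hf
    have := h k (e.symm.toLinearMap ∘ₗ f) (e.symm.surjective.comp hf)
    rwa [LinearEquiv.ker_comp] at this

open Pointwise

/-- The kernel of a reduction modulo a regular element is the reduction of the kernel. -/
theorem exists_ker_equiv_quotSMulTop {R : Type u} [CommRing R] {x : R} {M : Type u}
    [AddCommGroup M] [Module R M] (hM : IsSMulRegular M x) {k : ℕ} {f : (Fin k → R) →ₗ[R] M}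
    (hf : Function.Surjective f) :
    ∃ g : (Fin k → R ⧸ Ideal.span {x}) →ₗ[R ⧸ Ideal.span {x}] QuotSMulTop x M,
      Function.Surjective g ∧
      Nonempty (LinearMap.ker g ≃ₗ[R ⧸ Ideal.span {x}] QuotSMulTop x (LinearMap.ker f)) := by
  let π : R →+* R ⧸ Ideal.span {x} := Ideal.Quotient.mk _
  have hπ : Function.Surjective π := Ideal.Quotient.mk_surjective
  let q : M →ₗ[R] QuotSMulTop x M := Submodule.mkQ _
  let g : (Fin k → R ⧸ Ideal.span {x}) →ₗ[R ⧸ Ideal.span {x}] QuotSMulTop x M :=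
    Fintype.linearCombination _ fun i => q (f (Pi.single i 1))
  have hg : ∀ v : Fin k → R, g (fun i => π (v i)) = q (f v) := by
    intro v
    rw [apply_eq_sum_single f v, map_sum, Fintype.linearCombination_apply]
    refine Finset.sum_congr rfl fun i _ => ?_
    rw [map_smul]
    rfl
  let p : (Fin k → R) →ₗ[R] (Fin k → R ⧸ Ideal.span {x}) :=
    LinearMap.pi fun i => (Submodule.mkQ (Ideal.span {x})) ∘ₗ LinearMap.proj i
  have hp : ∀ v, p v = fun i => π (v i) := fun v => rfl
  have hpsurj : ∀ w, ∃ v, p v = w := fun w => by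
    choose v hv using fun i => hπ (w i)
    exact ⟨v, funext hv⟩
  let h : LinearMap.ker f →ₗ[R] LinearMap.ker g :=
    { toFun := fun z => ⟨p z, by rw [LinearMap.mem_ker, hp, hg, LinearMap.mem_ker.1 z.2, map_zero]⟩
      map_add' := fun y z => Subtype.ext (map_add p _ _)
      map_smul' := fun c z => Subtype.ext (map_smul p _ _) }
  have hsurj : Function.Surjective h := by
    rintro ⟨w, hw⟩
    obtain ⟨v, rfl⟩ := hpsurj w
    rw [LinearMap.mem_ker, hp, hg, Submodule.mkQ_apply, Submodule.Quotient.mk_eq_zero,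
      Submodule.mem_smul_pointwise_iff_exists] at hw
    obtain ⟨m, -, hm⟩ := hw
    obtain ⟨y, rfl⟩ := hf m
    -- Here `f v = x • f y`, so `v - x • y` lies in `ker f` and has the same reduction as `v`.
    refine ⟨⟨v - x • y, by rw [LinearMap.mem_ker, map_sub, map_smul, hm, sub_self]⟩,
      Subtype.ext (funext fun i => ?_)⟩
    change π (v i - x * y i) = π (v i)
    rw [map_sub, map_mul, show π x = 0 from
      Ideal.Quotient.eq_zero_iff_mem.2 (Ideal.mem_span_singleton_self x), zero_mul, sub_zero]
  have hker : LinearMap.ker h = x • (⊤ : Submodule R (LinearMap.ker f)) := by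
    ext ⟨z, hz⟩
    rw [Submodule.mem_smul_pointwise_iff_exists]
    constructor
    · intro hz0
      have hz0' : ∀ i, z i ∈ Ideal.span {x} := fun i =>
        Ideal.Quotient.eq_zero_iff_mem.1 (congrFun (congrArg Subtype.val hz0) i)
      choose y hy using fun i => Ideal.mem_span_singleton.1 (hz0' i)
      have hzy : z = x • y := funext hy
      -- From `x • f y = f z = 0` and the regularity of `x` on `M`, also `y ∈ ker f`.
      refine ⟨⟨y, ?_⟩, trivial, Subtype.ext hzy.symm⟩
      rw [LinearMap.mem_ker, hzy, map_smul] at hz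
      exact hM.right_eq_zero_of_smul hz
    · rintro ⟨y, -, hy⟩
      rw [LinearMap.mem_ker, ← hy]
      refine Subtype.ext (funext fun i => ?_)
      exact Ideal.Quotient.eq_zero_iff_mem.2
        (Ideal.mul_mem_right _ _ (Ideal.mem_span_singleton_self x))
  refine ⟨g, fun m => ?_, ⟨LinearEquiv.symm ?_⟩⟩
  · obtain ⟨m, rfl⟩ := Submodule.mkQ_surjective _ m
    obtain ⟨v, rfl⟩ := hf m
    exact ⟨_, hg v⟩
  · exact ((Submodule.quotEquivOfEq _ _ hker.symm).trans
      (h.quotKerEquivOfSurjective hsurj)).extendScalarsOfSurjective hπ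

/-- Any free cover of `M` reduces to one of `M/xM` with kernel the reduced syzygy. Syzygies lie in
free modules, so `x` stays regular on them, and the descent ends with a module free modulo `x`,
hence free. -/
theorem FreeSyzygy.of_quotSMulTop {R : Type u} [CommRing R] [IsLocalRing R] [IsNoetherianRing R]
    {x : R} (hx : x ∈ maximalIdeal R) (hR : IsSMulRegular R x) {n : ℕ} {M : Type u}
    [AddCommGroup M] [Module R M] [Module.Finite R M] (hM : IsSMulRegular M x)
    (h : FreeSyzygy (R ⧸ Ideal.span {x}) n (QuotSMulTop x M)) : FreeSyzygy R n M := by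
  induction n generalizing M with
  | zero =>
    have := Module.finitePresentation_of_finite R M
    exact (Module.free_quotSMulTop_iff_free R M (maximalIdeal_le_jacobson _ hx) hM).1 h
  | succ n ih =>
    intro k f hf
    obtain ⟨g, hg, ⟨e⟩⟩ := exists_ker_equiv_quotSMulTop hM hf
    refine ih ?_ ((h k g hg).congr e)
    intro y z hyz
    refine Subtype.ext (funext fun i => hR ?_)
    exact congrFun (congrArg Subtype.val hyz) i

/-- The syzygy theorem for regular local rings. -/
theorem freeSyzygy_of_isRegularLocalRing {n : ℕ} {R : Type u} [CommRing R] [IsRegularLocalRing R]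
    (hn : (maximalIdeal R).spanFinrank ≤ n) (M : Type u) [AddCommGroup M] [Module R M]
    [Module.Finite R M] : FreeSyzygy R n M := by
  induction n generalizing R M with
  | zero =>
    have hbot := (Submodule.spanFinrank_eq_zero_iff_eq_bot
      (maximalIdeal R).fg_of_isNoetherianRing).1 (Nat.le_zero.1 hn)
    let := (isField_iff_maximalIdeal_eq.2 hbot).toField
    exact (inferInstance : Module.Free R M)
  | succ n ih =>
    intro k f hf
    by_cases hbot : maximalIdeal R = ⊥
    -- A field has embedding dimension `0`, so the smaller bound `n` already holds.
    · refine ih ?_ _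
      simp [hbot]
    obtain ⟨x, hx, hx2⟩ : ∃ x ∈ maximalIdeal R, x ∉ maximalIdeal R ^ 2 := by
      by_contra! h
      exact hbot (maximalIdeal_eq_bot_of_le_sq h)
    obtain ⟨hreg, hlt⟩ := isRegularLocalRing_quotient_span_singleton hx hx2
    have := isDomain_of_isRegularLocalRing R
    have hx0 : x ≠ 0 := fun h => hx2 (h ▸ zero_mem _)
    have hR : IsSMulRegular R x := fun y z h => mul_left_cancel₀ hx0 h
    -- `x` may be a zero divisor on `M`, but not on a submodule of a free module. Each drop in
    -- embedding dimension is thus paid for by one syzygy.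
    have hK : IsSMulRegular (LinearMap.ker f) x := fun y z h =>
      Subtype.ext (funext fun i => hR (congrFun (congrArg Subtype.val h) i))
    have : Module.Finite (R ⧸ Ideal.span {x}) (QuotSMulTop x (LinearMap.ker f)) :=
      Module.Finite.of_restrictScalars_finite R _ _
    exact FreeSyzygy.of_quotSMulTop hx hR hK (ih (by lia) _)

end RegularLocalRing

/-! ### Lifting a whole graded resolution -/

/-- A graded free resolution of `Gr_𝔞(R)/in_𝔞(I)` lifts to a free resolution of `R/I`. -/
theorem exists_lift_freeRes {R : Type*} [CommRing R] [IsNoetherianRing R] [IsLocalRing R]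
    {a : Ideal R} (ha : a ≠ ⊤) {I : Ideal R} {b : ℕ → ℕ} {d : ∀ k : ℕ, Fin (b k) → ℤ}
    {C : FreeRes (AssocGr a) (initIdeal a I) b} (hC : C.IsGraded d) :
    ∃ D : FreeRes R I b, D.IsLift C d := by
  -- `R` is viewed as a free module of rank one with shift `0`, so that the augmentation is lifted
  -- like every other map.
  let e₀ : Fin 1 → ℤ := fun _ => 0
  let I₀ : Submodule R (Fin 1 → R) := Submodule.comap (LinearMap.proj 0) I
  let J₀ : Submodule (AssocGr a) (Fin 1 → AssocGr a) :=
    Submodule.comap (LinearMap.proj 0) (initIdeal a I)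
  have hI₀ : IsInitSubmodule a e₀ I₀ J₀ := by
    refine ⟨fun {m v} hv hvJ => ?_, fun {m g} hg hgm => ?_⟩
    · obtain ⟨c, hcI, hc, h⟩ := exists_homogComp_eq_of_mem_initIdeal a hvJ (m - 0)
      refine ⟨fun _ => c, hcI, (mem_vecFilt_iff a e₀).2 fun _ => hc, funext fun i => ?_⟩
      rw [Subsingleton.elim i 0]
      exact h.symm.trans (homogComp_eq_self a (hv 0))
    · exact intClass_mem_initIdeal a hg ((mem_vecFilt_iff a e₀).1 hgm 0)
  let φ₀ : (Fin (b 0) → AssocGr a) →ₗ[AssocGr a] (Fin 1 → AssocGr a) :=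
    LinearMap.pi fun _ => C.aug
  have hφ₀ : ∀ i, IsHomogVec a e₀ (d 0 i) (φ₀ (Pi.single i 1)) := fun i _ n hn =>
    hC.aug i n (by simpa [e₀] using hn)
  have hrange₀ : LinearMap.range φ₀ = J₀ := by
    have h := C.exact_quot.linearMap_ker_eq
    rw [Submodule.ker_mkQ] at h
    ext v
    change _ ↔ v 0 ∈ initIdeal a I
    rw [h]
    constructor
    · rintro ⟨w, rfl⟩
      exact ⟨w, rfl⟩
    · rintro ⟨w, hw⟩
      exact ⟨w, funext fun i => by rw [Subsingleton.elim i 0, ← hw]; rfl⟩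
  have hker₀ : LinearMap.ker φ₀ = LinearMap.ker C.aug := by
    ext w
    exact ⟨fun h => congrFun h 0, fun h => funext fun _ => h⟩
  obtain ⟨δ₀, hδ₀, hmap₀, hbasis₀, hinit₀⟩ := exists_lift a e₀ (d 0) ha hI₀ hφ₀ hrange₀
  rw [hker₀] at hinit₀
  let K' : ∀ k, Submodule (AssocGr a) (Fin (b k) → AssocGr a) := fun k =>
    k.casesOn (LinearMap.ker C.aug) fun k => LinearMap.ker (C.map k)
  have hrange : ∀ k, LinearMap.range (C.map k) = K' k := fun k => by
    cases k with
    | zero => exact C.exact_aug.linearMap_ker_eq.symm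
    | succ k => exact (C.exact_map k).linearMap_ker_eq.symm
  choose δ hδ hmap hbasis hinit using fun (k : ℕ)
    (K : {K : Submodule R (Fin (b k) → R) // IsInitSubmodule a (d k) K (K' k)}) =>
    exists_lift a (d k) (d (k + 1)) ha K.2 (hC.map k) (hrange k)
  -- Each kernel is carried along with its proof of the invariant, since the next map is chosen from
  -- both.
  let K : ∀ k, {K : Submodule R (Fin (b k) → R) // IsInitSubmodule a (d k) K (K' k)} := fun k =>
    Nat.rec ⟨LinearMap.ker δ₀, hinit₀⟩ (fun k K => ⟨LinearMap.ker (δ k K), hinit k K⟩) k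
  have hI : LinearMap.range (LinearMap.proj 0 ∘ₗ δ₀) = I := by
    rw [LinearMap.range_comp, hδ₀]
    exact Submodule.map_comap_eq_of_surjective (fun x => ⟨fun _ => x, rfl⟩) I
  have hker : LinearMap.ker (LinearMap.proj 0 ∘ₗ δ₀) = LinearMap.ker δ₀ := by
    ext w
    exact ⟨fun h => funext fun i => by rw [Subsingleton.elim i 0]; exact h,
      fun h => congrFun h 0⟩
  let D : FreeRes R I b :=
    { aug := LinearMap.proj 0 ∘ₗ δ₀
      map := fun k => δ k (K k)
      exact_quot := by rw [LinearMap.exact_iff, Submodule.ker_mkQ, hI]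
      exact_aug := by rw [LinearMap.exact_iff, hker, hδ 0 (K 0)]; rfl
      exact_map := fun k => by rw [LinearMap.exact_iff, hδ (k + 1) (K (k + 1))] }
  have hcoord : ∀ {m : ℤ} {g : Fin 1 → R}, g ∈ vecFilt a e₀ m → g 0 ∈ intPow a m := fun hg => by
    simpa [e₀] using (mem_vecFilt_iff a e₀).1 hg 0
  have hclass : ∀ (m : ℤ) (g : Fin 1 → R), vecIntClass a e₀ m g 0 = intClass a m (g 0) :=
    fun m g => by simp [vecIntClass, e₀]
  refine ⟨D, fun n x => ?_, fun k m x => ?_, fun i => ?_, fun k i => ?_⟩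
  · obtain ⟨h₁, h₂⟩ := hmap₀ x.2
    refine ⟨(mem_intPow_natCast a).1 (hcoord h₁), ?_⟩
    rw [← intClass_natCast, vecClass_eq_vecIntClass]
    exact (hclass _ _).symm.trans (congrFun h₂ 0)
  · obtain ⟨h₁, h₂⟩ := hmap k (K k) x.2
    refine ⟨h₁, ?_⟩
    rw [vecClass_eq_vecIntClass, vecClass_eq_vecIntClass]
    exact h₂
  · obtain ⟨h₁, h₂, h₃⟩ := hbasis₀ i
    have h := (hclass _ _).symm.trans (congrFun h₂ 0)
    refine (initForm_eq_intClass a (hcoord h₁) fun h0 => ?_).trans h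
    rw [h] at h0
    exact congrFun (h₃ (funext fun _ => h0)) 0
  · obtain ⟨h₁, h₂, h₃⟩ := hbasis k (K k) i
    refine (vecInitForm_eq_vecIntClass a (d k) h₁ fun h0 => h₃ ?_).trans h₂
    rw [← h₂, h0]

/-! ### Finite free resolutions from free syzygies -/

section FiniteResolution

universe u

variable {R : Type u} [CommRing R] [IsLocalRing R]

/-- A free cover of a finite module, an isomorphism if the module is free. -/
theorem exists_free_cover (M : Type u) [AddCommGroup M] [Module R M] [Module.Finite R M] :
    ∃ (k : ℕ) (f : (Fin k → R) →ₗ[R] M), Function.Surjective f ∧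
      (Module.Free R M → LinearMap.ker f = ⊥) ∧ (Subsingleton M → k = 0) := by
  -- Covering a free module by a basis makes the next kernel vanish, and the zero module gets rank
  -- `0`; this makes the resolution stop.
  by_cases h : Module.Free R M
  · refine ⟨_, (Module.finBasis R M).equivFun.symm.toLinearMap, LinearEquiv.surjective _,
      fun _ => LinearEquiv.ker _, fun _ => Module.finrank_zero_of_subsingleton⟩
  · obtain ⟨k, f, hf⟩ := Module.Finite.exists_fin' R M
    exact ⟨k, f, hf, fun h' => absurd h' h, fun _ => absurd (Module.Free.of_subsingleton R M) h⟩

/-- If some syzygy modules of `I` are free, `R/I` has a finite free resolution. -/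
theorem exists_finite_freeRes [IsNoetherianRing R] {I : Ideal R} {n : ℕ} (hI : FreeSyzygy R n I) :
    ∃ b : ℕ → ℕ, (∃ N : ℕ, ∀ j : ℕ, N ≤ j → b j = 0) ∧ Nonempty (FreeRes R I b) := by
  obtain ⟨k₀, f₀, hf₀, hfree₀, -⟩ := exists_free_cover (R := R) I
  choose c f hf hfree hzero using fun s : Σ k : ℕ, Submodule R (Fin k → R) =>
    exists_free_cover (R := R) s.2
  -- Successive syzygies: each entry is a rank together with the kernel, inside the free module of
  -- that rank, of the preceding cover.
  let s : ℕ → Σ k : ℕ, Submodule R (Fin k → R) := fun k =>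
    Nat.rec ⟨k₀, LinearMap.ker f₀⟩ (fun _ s => ⟨c s, LinearMap.ker (f s)⟩) k
  have hstep : ∀ (m j : ℕ), FreeSyzygy R (m + 1) (s j).2 → FreeSyzygy R m (s (j + 1)).2 :=
    fun m j h => h (c (s j)) (f (s j)) (hf (s j))
  have hbot : ∀ m j : ℕ, FreeSyzygy R m (s j).2 → (s (j + m + 1)).2 = ⊥ := by
    intro m
    induction m with
    | zero => exact fun j h => hfree (s j) h
    | succ m ih =>
      intro j h
      have := ih (j + 1) (hstep m j h)
      rwa [Nat.add_right_comm j 1 m] at this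
  have hstart : ∃ m, (s m).2 = ⊥ := by
    cases n with
    | zero => exact ⟨0, hfree₀ hI⟩
    | succ n => exact ⟨0 + n + 1, hbot n 0 (hI k₀ f₀ hf₀)⟩
  obtain ⟨N, hN⟩ := hstart
  have hsucc : ∀ j, (s j).2 = ⊥ → (s (j + 1)).1 = 0 ∧ (s (j + 1)).2 = ⊥ := fun j h => by
    have hsub : Subsingleton (s j).2 := by rw [h]; infer_instance
    exact ⟨hzero _ hsub, hfree _ (Module.Free.of_subsingleton R _)⟩
  have hvanish : ∀ i, (s (N + i)).2 = ⊥ := fun i => by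
    induction i with
    | zero => exact hN
    | succ i ih => exact (hsucc _ ih).2
  have hrange : ∀ s : Σ k : ℕ, Submodule R (Fin k → R),
      LinearMap.range (s.2.subtype ∘ₗ f s) = s.2 := fun s => by
    rw [LinearMap.range_comp_of_range_eq_top _ (LinearMap.range_eq_top.2 (hf s)),
      Submodule.range_subtype]
  have hker : ∀ s : Σ k : ℕ, Submodule R (Fin k → R),
      LinearMap.ker (s.2.subtype ∘ₗ f s) = LinearMap.ker (f s) := fun s =>
    LinearMap.ker_comp_of_ker_eq_bot _ s.2.ker_subtype
  -- The syzygy at index `N` is zero, and its cover has rank `(s (N + 1)).1`, so the ranks vanish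
  -- only from `N + 1` on.
  refine ⟨fun k => (s k).1, ⟨N + 1, fun j hj => ?_⟩, ⟨
    { aug := I.subtype ∘ₗ f₀
      map := fun k => (s k).2.subtype ∘ₗ f (s k)
      exact_quot := ?_
      exact_aug := ?_
      exact_map := fun k => ?_ }⟩⟩
  · obtain ⟨i, rfl⟩ := Nat.exists_eq_add_of_le hj
    have := (hsucc _ (hvanish i)).1
    rwa [Nat.add_right_comm] at this
  · rw [LinearMap.exact_iff, Submodule.ker_mkQ,
      LinearMap.range_comp_of_range_eq_top _ (LinearMap.range_eq_top.2 hf₀),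
      Submodule.range_subtype]
  · rw [LinearMap.exact_iff, hrange (s 0)]
    exact LinearMap.ker_comp_of_ker_eq_bot _ I.ker_subtype
  · rw [LinearMap.exact_iff, hrange (s (k + 1))]
    exact hker (s k)

end FiniteResolution

end

theorem mainTheorem1 {k : Type*} [Field k] (s : ℕ) (H : Ideal (MvPolynomial (Fin s) k)) [H.IsPrime]
    (L : Ideal (MvPolynomial (Fin s) k ⧸ H)) [L.IsPrime]
    (AL : Type*) [CommRing AL] [Algebra (MvPolynomial (Fin s) k ⧸ H) AL]
    [IsLocalization.AtPrime AL L]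
    (a : Ideal AL) (ha : a = L.map (algebraMap (MvPolynomial (Fin s) k ⧸ H) AL)) :
    (∀ I : Ideal AL,
      (∀ (n : ℕ) (x : ↥(a ^ n)),
        grClass a n x ∈ initIdeal a I ↔ (x : AL) ∈ I ⊔ a ^ (n + 1)) ∧
      ∀ (b : ℕ → ℕ) (d : ∀ j : ℕ, Fin (b j) → ℤ)
        (C : FreeRes (AssocGr a) (initIdeal a I) b), C.IsGraded d →
          ∃ D : FreeRes AL I b, D.IsLift C d) ∧
    (IsRegularLocalRing AL → ∀ I : Ideal AL,
      ∃ b : ℕ → ℕ, (∃ N : ℕ, ∀ j : ℕ, N ≤ j → b j = 0) ∧ Nonempty (FreeRes AL I b)) := by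
  have : IsLocalRing AL := IsLocalization.AtPrime.isLocalRing AL L
  have : IsNoetherianRing AL := IsLocalization.isNoetherianRing L.primeCompl AL inferInstance
  -- Properness of `𝔞` is what Krull's intersection theorem needs in the lifting.
  have hne : a ≠ ⊤ := by
    rw [ha, IsLocalization.AtPrime.map_eq_maximalIdeal L AL]
    exact (IsLocalRing.maximalIdeal.isMaximal AL).ne_top
  refine ⟨fun I => ⟨grClass_mem_initIdeal_iff a I, fun b d C hC => exists_lift_freeRes hne hC⟩,
    fun hreg I => exists_finite_freeRes (freeSyzygy_of_isRegularLocalRing le_rfl I)⟩
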